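/- Let $k$ be a field of characteristic zero (for instance an algebraically closed one), let $h\in k[x]$ be a nonzero polynomial of degree $N$, and let $A_h$ be the $k$-algebra generated by $x$ and $t$ subject to the relation $tx=xt+h(x)$. Let $\psi=\gcd(h,h')$ (monic), $S=\{\psi^n : n\ge 0\}$, let $\mathcal B=A_h[S^{-1}]$ be the Ore localization of $A_h$, which contains $A_h$ and $R_S=k[x][S^{-1}]=k[x][\psi^{-1}]$, and let $d_S$ be the extension to $R_S$ of the derivation $d=h(x)\,\partial_x$ of $k[x]$. An element $H\in A_h$ is called special if $H=0$ or $H=h_1t+\dots+h_nt^n$ with $n\ge 1$, $h_i\in k[x]$ and $\deg h_i<\deg\psi$ for all $i$. For a special $H$ let $E_H$ be the derivation $f\mapsto[\psi^{-1}H,f]$ of $A_h$ (bracket taken in $\mathcal B$). For $w\in A_h$ let $\mathrm{ad}_w=[w,-]$, and for $s\in k[x]$ let $\Delta_s$ be the derivation of $A_h$ with $\Delta_s(x)=0$ and $\Delta_s(t)=s(x)$. For $r\in k[x]$ let $\sigma_r$ be the automorphism of $A_h$ with $\sigma_r(x)=x$, $\sigma_r(t)=t+r(x)$, and for $a\in k^*$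 with $h(ax)=a^Nh(x)$ let $\tau_a$ be the automorphism of $A_h$ with $\tau_a(x)=ax$, $\tau_a(t)=a^{N-1}t$. For a derivation $D$ of $A_h$ let $\mathrm{Aut}_D(A_h)$ be the group of all $k$-algebra automorphisms $\rho$ of $A_h$ with $\rho D=D\rho$. **Proposition.** Let $w\in A_h$, let $H\in A_h$ be special, let $s\in k[x]$ with $\deg s<\deg h$, and put $$D=\mathrm{ad}_w+E_H+\Delta_s=[w^*,-]+\Delta_s,\qquad w^*=w+\psi^{-1}H\in\mathcal B .$$ Let $r\in k[x]$ and let $a\in k^*$ satisfy $h(ax)=a^Nh(x)$. Let $\rho=\sigma_r\circ\tau_a$, and denote also by $\rho$ its unique extension to $\mathcal B$. Then $\rho\in\mathrm{Aut}_D(A_h)$ if and only if $$\rho(w^*)-w^*\in R_S\quad\text{and}\quad d_S\bigl(\rho(w^*)-w^*\bigr)=a^{1-N}s(ax)-s(x).$$ -/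

import Mathlib

open Polynomial

noncomputable section

namespace DiffOre

/-! ### A general source of Ore sets -/

section General

variable {R : Type*} [Ring R]

theorem pow_left_of_mul_eq_zero (s : R) (c : R → R) (hc : ∀ r, c r = s * r - r * s) (r : R)
    (hr : r * s = 0) (n : ℕ) : c^[n] r = s ^ n * r := by
  induction n with
  | zero => simp
  | succ n ih =>
    rw [Function.iterate_succ_apply', ih, hc, mul_assoc (s ^ n) r s, hr, mul_zero, sub_zero,
      pow_succ', mul_assoc]

theorem iterate_comm_zero (s : R) (c : R →+ R) (hc : ∀ r, c r = s * r - r * s) (N : ℕ) :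
    ∀ (m n : ℕ) (a b : R), m + n = N → c^[m] a = 0 → c^[n] b = 0 → c^[N] (a * b) = 0 := by
  have hz : ∀ n : ℕ, c^[n] 0 = 0 := fun n => by
    induction n with
    | zero => rfl
    | succ n ih => rw [Function.iterate_succ_apply, map_zero, ih]
  induction N with
  | zero =>
    intro m n a b hmn ha hb
    obtain rfl : m = 0 := by omega
    simp only [Function.iterate_zero, id_eq] at ha
    simp [ha]
  | succ N ih =>
    intro m n a b hmn ha hb
    have hleib : c (a * b) = c a * b + a * c b := by
      simp only [hc]; noncomm_ring
    rw [Function.iterate_succ_apply, hleib, iterate_map_add]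
    rcases m with _ | m
    · simp only [Function.iterate_zero, id_eq] at ha
      simp [ha, hz]
    rcases n with _ | n
    · simp only [Function.iterate_zero, id_eq] at hb
      simp [hb, hz]
    rw [ih m (n + 1) (c a) b (by omega) ha hb, ih (m + 1) n a (c b) (by omega) ha hb, add_zero]

end General

/-! ### The algebra `A_h` -/

/-- The two generators of `A_h`. -/
inductive Gen : Type
  | x : Gen
  | t : Gen

variable {k : Type*} [Field k]

/-- The defining relation `t x = x t + h(x)`. -/
inductive Rel (h : k[X]) : FreeAlgebra k Gen → FreeAlgebra k Gen → Prop
  | comm : Rel h (FreeAlgebra.ι k Gen.t * FreeAlgebra.ι k Gen.x)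
      (FreeAlgebra.ι k Gen.x * FreeAlgebra.ι k Gen.t + aeval (FreeAlgebra.ι k Gen.x) h)

/-- `A_h`: the `k`-algebra generated by `x` and `t` subject to `t x = x t + h(x)`. -/
def OreExt (h : k[X]) : Type _ := RingQuot (Rel h)

instance (h : k[X]) : Ring (OreExt h) := inferInstanceAs (Ring (RingQuot (Rel h)))

instance (h : k[X]) : Algebra k (OreExt h) := inferInstanceAs (Algebra k (RingQuot (Rel h)))

/-- The quotient map from the free algebra. -/
def mk (h : k[X]) : FreeAlgebra k Gen →ₐ[k] OreExt h := RingQuot.mkAlgHom k (Rel h)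

/-- The generator `x` of `A_h`. -/
def x (h : k[X]) : OreExt h := mk h (FreeAlgebra.ι k Gen.x)

/-- The generator `t` of `A_h`. -/
def t (h : k[X]) : OreExt h := mk h (FreeAlgebra.ι k Gen.t)

/-- The canonical map `k[x] → A_h`. -/
def poly (h : k[X]) : k[X] →ₐ[k] OreExt h := aeval (x h)

@[simp] theorem poly_X (h : k[X]) : poly h X = x h := by simp [poly]

theorem t_mul_x (h : k[X]) : t h * x h = x h * t h + poly h h := by
  have := RingQuot.mkAlgHom_rel k (Rel.comm (h := h))
  have e : poly h h = mk h (aeval (FreeAlgebra.ι k Gen.x) h) := by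
    rw [poly, x, aeval_algHom_apply]
  rw [e]
  rw [map_add, map_mul, map_mul] at this
  exact this

/-- The universal property of `A_h`. -/
def lift {B : Type*} [Ring B] [Algebra k B] (h : k[X]) (a b : B)
    (hab : b * a = a * b + aeval a h) : OreExt h →ₐ[k] B :=
  RingQuot.liftAlgHom k (s := Rel h) ⟨FreeAlgebra.lift k (fun g => Gen.casesOn g a b), by
    rintro _ _ ⟨⟩
    rw [map_mul, map_add, map_mul, ← aeval_algHom_apply]
    simpa using hab⟩

@[simp] theorem lift_x {B : Type*} [Ring B] [Algebra k B] (h : k[X]) (a b : B)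
    (hab : b * a = a * b + aeval a h) : lift h a b hab (x h) = a :=
  (RingQuot.liftAlgHom_mkAlgHom_apply k _ _ _).trans (by simp)

@[simp] theorem lift_t {B : Type*} [Ring B] [Algebra k B] (h : k[X]) (a b : B)
    (hab : b * a = a * b + aeval a h) : lift h a b hab (t h) = b :=
  (RingQuot.liftAlgHom_mkAlgHom_apply k _ _ _).trans (by simp)

theorem induct {h : k[X]} {P : OreExt h → Prop} (hC : ∀ c : k, P (algebraMap k _ c))
    (hx : P (x h)) (ht : P (t h)) (hadd : ∀ a b, P a → P b → P (a + b))
    (hmul : ∀ a b, P a → P b → P (a * b)) (a : OreExt h) : P a := by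
  obtain ⟨a, rfl⟩ := RingQuot.mkAlgHom_surjective k (Rel h) a
  change P (mk h a)
  induction a using FreeAlgebra.induction with
  | grade0 r => rw [AlgHom.commutes]; exact hC r
  | grade1 g => cases g; exacts [hx, ht]
  | mul a b ha hb => rw [map_mul]; exact hmul _ _ ha hb
  | add a b ha hb => rw [map_add]; exact hadd _ _ ha hb

theorem algHom_ext {B : Type*} [Ring B] [Algebra k B] {h : k[X]} {f g : OreExt h →ₐ[k] B}
    (hx : f (x h) = g (x h)) (ht : f (t h) = g (t h)) : f = g := by
  ext a
  induction a using induct with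
  | hC c => simp
  | hx => exact hx
  | ht => exact ht
  | hadd a b ha hb => simp [ha, hb]
  | hmul a b ha hb => simp [ha, hb]

theorem poly_comm (h : k[X]) (p q : k[X]) : poly h p * poly h q = poly h q * poly h p := by
  rw [← map_mul, mul_comm, map_mul]

theorem t_mul_poly (h : k[X]) (p : k[X]) :
    t h * poly h p = poly h p * t h + poly h (h * derivative p) := by
  induction p using Polynomial.induction_on' with
  | add p q hp hq => simp only [map_add, mul_add, add_mul, hp, hq]; abel
  | monomial n c =>
    induction n with
    | zero => simp [poly, Algebra.commutes]
    | succ n ih =>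
      have e : (monomial (n + 1) c : k[X]) = monomial n c * X := by rw [monomial_mul_X]
      rw [e, map_mul, poly_X, ← mul_assoc, ih, add_mul, mul_assoc, t_mul_x, mul_add, ← poly_X,
        ← map_mul, ← map_mul, ← mul_assoc, ← map_mul, add_assoc, ← map_add]
      congr 2
      rw [derivative_mul, derivative_X]; ring

/-! ### Normal forms: `A_h` is a free left `k[x]`-module on the powers of `t` -/

/-- Coefficientwise `h ∂_x` on `k[x][T]`, as an additive map. -/
def coeffDAux (h : k[X]) : k[X][X] →+ k[X][X] where
  toFun p := p.sum fun i c => monomial i (h * derivative c)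
  map_zero' := by simp
  map_add' p q := by
    rw [sum_add_index] <;> simp [mul_add]

theorem coeffDAux_monomial (h : k[X]) (i : ℕ) (c : k[X]) :
    coeffDAux h (monomial i c) = monomial i (h * derivative c) := by
  simp [coeffDAux, sum_monomial_index]

/-- Coefficientwise `h ∂_x` on `k[x][T]`. -/
def coeffD (h : k[X]) : k[X][X] →ₗ[k] k[X][X] :=
  { coeffDAux h with
    map_smul' := fun c p => by
      change coeffDAux h (c • p) = c • coeffDAux h p
      induction p using Polynomial.induction_on' with
      | add a b ha hb => rw [smul_add, map_add, map_add, ha, hb, smul_add]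
      | monomial n d =>
        rw [smul_monomial, coeffDAux_monomial, coeffDAux_monomial, smul_monomial, derivative_smul,
          mul_smul_comm] }

theorem coeffD_monomial (h : k[X]) (i : ℕ) (c : k[X]) :
    coeffD h (monomial i c) = monomial i (h * derivative c) := coeffDAux_monomial h i c

/-- The action of `x` on `k[x][T]`. -/
def opX : Module.End k k[X][X] := LinearMap.mulLeft k (C X)

/-- The action of `t` on `k[x][T]`. -/
def opT (h : k[X]) : Module.End k k[X][X] := LinearMap.mulLeft k X + coeffD h

theorem C_smul_aux (c : k) (q : k[X][X]) : c • q = (C c : k[X]) • q := by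
  ext i : 1
  rw [coeff_smul, coeff_smul, smul_eq_mul, ← smul_eq_C_mul]

theorem aeval_opX (p : k[X]) (q : k[X][X]) :
    aeval (opX : Module.End k k[X][X]) p q = C p * q := by
  induction p using Polynomial.induction_on' with
  | add a b ha hb => simp [ha, hb, add_mul]
  | monomial n c =>
    have : ∀ q : k[X][X], ((opX : Module.End k k[X][X]) ^ n) q = C (X ^ n) * q := by
      intro q
      rw [opX, LinearMap.pow_mulLeft]; simp
    rw [aeval_monomial, Module.End.mul_apply, this, Module.algebraMap_end_apply,
      ← C_mul_X_pow_eq_monomial, map_mul, mul_assoc]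
    rw [C_smul_aux, smul_eq_C_mul]

theorem op_rel (h : k[X]) : opT h * opX = opX * opT h + aeval (opX : Module.End k k[X][X]) h := by
  apply LinearMap.ext
  intro q
  induction q using Polynomial.induction_on' with
  | add a b ha hb => simp only [map_add, ha, hb]
  | monomial n c =>
    rw [LinearMap.add_apply, aeval_opX]
    simp only [LinearMap.add_apply, Module.End.mul_apply, opX, opT, LinearMap.mulLeft_apply,
      C_mul_monomial, coeffD_monomial, mul_add, add_assoc, X_mul_monomial]
    rw [← map_add (monomial n), derivative_mul, derivative_X]
    congr 2
    ring

/-- The representation of `A_h` on `k[x][T]`. -/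
def rep (h : k[X]) : OreExt h →ₐ[k] Module.End k k[X][X] := lift h opX (opT h) (op_rel h)

/-- `∑ pᵢ Tⁱ ↦ ∑ pᵢ tⁱ`. -/
def nf (h : k[X]) (p : k[X][X]) : OreExt h := eval₂ (poly h : k[X] →+* OreExt h) (t h) p

theorem nf_add (h : k[X]) (p q : k[X][X]) : nf h (p + q) = nf h p + nf h q := eval₂_add _ _

theorem nf_monomial (h : k[X]) (n : ℕ) (c : k[X]) :
    nf h (monomial n c) = poly h c * t h ^ n := by
  rw [nf, eval₂_monomial]; rfl

theorem nf_rep (h : k[X]) (a : OreExt h) : ∀ p, nf h (rep h a p) = a * nf h p := by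
  induction a using induct with
  | hC c =>
    intro p
    rw [AlgHom.commutes, Module.algebraMap_end_apply]
    induction p using Polynomial.induction_on' with
    | add a b ha hb => rw [smul_add, nf_add, nf_add, ha, hb, mul_add]
    | monomial n d => rw [smul_monomial, nf_monomial, nf_monomial, map_smul, Algebra.smul_def, mul_assoc]
  | hx =>
    intro p
    induction p using Polynomial.induction_on' with
    | add a b ha hb => rw [map_add, nf_add, nf_add, ha, hb, mul_add]
    | monomial n d =>
      simp only [rep, lift_x, opX, LinearMap.mulLeft_apply, C_mul_monomial, nf_monomial, map_mul,
        poly_X, mul_assoc]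
  | ht =>
    intro p
    induction p using Polynomial.induction_on' with
    | add a b ha hb => rw [map_add, nf_add, nf_add, ha, hb, mul_add]
    | monomial n d =>
      simp only [rep, lift_t, opT, LinearMap.add_apply, LinearMap.mulLeft_apply, X_mul_monomial,
        coeffD_monomial, nf_add, nf_monomial]
      rw [← mul_assoc, t_mul_poly, add_mul, mul_assoc, pow_succ']
  | hadd a b ha hb => intro p; rw [map_add, LinearMap.add_apply, nf_add, ha, hb, add_mul]
  | hmul a b ha hb => intro p; rw [map_mul, Module.End.mul_apply, ha, hb, mul_assoc]

theorem nf_rep_one (h : k[X]) (a : OreExt h) : nf h (rep h a 1) = a := by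
  rw [nf_rep]
  simp [nf]

theorem rep_poly (h p : k[X]) (q : k[X][X]) : rep h (poly h p) q = C p * q := by
  rw [poly, ← aeval_algHom_apply, rep, lift_x, aeval_opX]

theorem poly_injective (h : k[X]) : Function.Injective (poly h) := by
  intro p q hpq
  have := congrArg (fun a => rep h a 1) hpq
  simpa [rep_poly] using this

theorem poly_mul_left_cancel {h p : k[X]} (hp : p ≠ 0) {a : OreExt h} (ha : poly h p * a = 0) :
    a = 0 := by
  have h1 := congrArg (fun a => rep h a 1) ha
  simp only [map_mul, Module.End.mul_apply, rep_poly, map_zero, LinearMap.zero_apply,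
    mul_eq_zero, C_eq_zero, hp, false_or] at h1
  rw [← nf_rep_one h a, h1]
  simp [nf]

/-! ### The polynomial `ψ = gcd(h, h')` -/

open Classical in
/-- `ψ`, the monic greatest common divisor of `h` and `h'`. -/
def psi (h : k[X]) : k[X] := normalize (EuclideanDomain.gcd h (derivative h))

theorem psi_dvd (h : k[X]) : psi h ∣ h := by
  classical
  exact normalize_dvd_iff.2 (EuclideanDomain.gcd_dvd_left _ _)

theorem psi_dvd_derivative (h : k[X]) : psi h ∣ derivative h := by
  classical
  exact normalize_dvd_iff.2 (EuclideanDomain.gcd_dvd_right _ _)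

theorem dvd_psi {h p : k[X]} (h₁ : p ∣ h) (h₂ : p ∣ derivative h) : p ∣ psi h := by
  classical
  exact dvd_normalize_iff.2 (EuclideanDomain.dvd_gcd h₁ h₂)

theorem psi_ne_zero {h : k[X]} (hh : h ≠ 0) : psi h ≠ 0 := fun e =>
  hh (zero_dvd_iff.1 (e ▸ psi_dvd h))

/-! ### The Ore set `S = {ψⁿ}` and the localization `𝓑 = A_h[S⁻¹]` -/

/-- `S = {ψⁿ | n ≥ 0}`, as a subset of `A_h`. -/
def S (h : k[X]) : Submonoid (OreExt h) := Submonoid.powers (poly h (psi h))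

theorem exists_left_multiple (h : k[X]) (a : OreExt h) :
    ∀ n : ℕ, ∃ (m : ℕ) (b : OreExt h), poly h (psi h) ^ m * a = b * poly h (psi h) ^ n := by
  induction a using induct with
  | hC c => exact fun n => ⟨n, algebraMap k _ c, (Algebra.commutes _ _).symm⟩
  | hx =>
    refine fun n => ⟨n, x h, ?_⟩
    rw [← poly_X, ← map_pow, poly_comm]
  | ht =>
    intro n
    refine ⟨n + 1, t h * poly h (psi h) - poly h (h * (C ((n : k) + 1) * derivative (psi h))), ?_⟩
    have e := t_mul_poly h (psi h ^ (n + 1))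
    rw [derivative_pow, add_tsub_cancel_right] at e
    rw [sub_mul, mul_assoc, ← pow_succ', ← map_pow, ← map_pow, e, ← map_mul]
    rw [add_sub_assoc, ← map_sub, eq_comm, add_eq_left, ← map_zero (poly h)]
    congr 1
    push_cast
    ring
  | hadd a b ha hb =>
    intro n
    obtain ⟨m, a', ha'⟩ := ha n
    obtain ⟨m', b', hb'⟩ := hb n
    refine ⟨m + m', poly h (psi h) ^ m' * a' + poly h (psi h) ^ m * b', ?_⟩
    rw [mul_add, add_mul, mul_assoc, mul_assoc, ← ha', ← hb', ← mul_assoc, ← mul_assoc, ← pow_add,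
      ← pow_add, add_comm m' m]
  | hmul a b ha hb =>
    intro n
    obtain ⟨m, b', hb'⟩ := hb n
    obtain ⟨m', a', ha'⟩ := ha m
    refine ⟨m', a' * b', ?_⟩
    rw [← mul_assoc, ha', mul_assoc, hb', mul_assoc]

theorem ad_nilpotent (h p : k[X]) (c : OreExt h →+ OreExt h)
    (hc : ∀ a, c a = poly h p * a - a * poly h p) (a : OreExt h) : ∃ n : ℕ, c^[n] a = 0 := by
  have hz : ∀ n : ℕ, c^[n] 0 = 0 := fun n => by
    induction n with
    | zero => rfl
    | succ n ih => rw [Function.iterate_succ_apply, map_zero, ih]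
  have hp : ∀ q, c (poly h q) = 0 := fun q => by rw [hc, poly_comm, sub_self]
  induction a using induct with
  | hC r => exact ⟨1, by simp [hc, Algebra.commutes]⟩
  | hx => exact ⟨1, by simpa using hp X⟩
  | ht =>
    refine ⟨2, ?_⟩
    rw [Function.iterate_succ_apply, Function.iterate_one, hc (t h), t_mul_poly, sub_add_cancel_left,
      map_neg, hp, neg_zero]
  | hadd a b ha hb =>
    obtain ⟨m, ha⟩ := ha
    obtain ⟨n, hb⟩ := hb
    refine ⟨m + n, ?_⟩
    rw [iterate_map_add, add_comm m n, Function.iterate_add_apply, ha, hz, zero_add, add_comm n m,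
      Function.iterate_add_apply, hb, hz]
  | hmul a b ha hb =>
    obtain ⟨m, ha⟩ := ha
    obtain ⟨n, hb⟩ := hb
    exact ⟨m + n, iterate_comm_zero _ c hc (m + n) m n a b rfl ha hb⟩

theorem right_cancel_zero (h p : k[X]) (a : OreExt h) (ha : a * poly h p = 0) :
    ∃ n : ℕ, poly h p ^ n * a = 0 := by
  let c : OreExt h →+ OreExt h := AddMonoidHom.mulLeft (poly h p) - AddMonoidHom.mulRight (poly h p)
  have hc : ∀ a, c a = poly h p * a - a * poly h p := fun a => rfl
  obtain ⟨n, hn⟩ := ad_nilpotent h p c hc a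
  exact ⟨n, by rw [← pow_left_of_mul_eq_zero (poly h p) c hc a ha n, hn]⟩

theorem nonempty_oreSet (h : k[X]) : Nonempty (OreLocalization.OreSet (S h)) := by
  rw [OreLocalization.nonempty_oreSet_iff]
  constructor
  · rintro a b ⟨_, n, rfl⟩ hab
    obtain ⟨m, hm⟩ := right_cancel_zero h (psi h ^ n) (a - b) (by
      rw [sub_mul, sub_eq_zero, map_pow]; exact hab)
    refine ⟨⟨_, n * m, rfl⟩, ?_⟩
    rw [← sub_eq_zero, ← mul_sub]
    simpa [pow_mul] using hm
  · rintro a ⟨_, n, rfl⟩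
    obtain ⟨m, b, hb⟩ := exists_left_multiple h a n
    exact ⟨b, ⟨_, m, rfl⟩, hb⟩

instance (h : k[X]) : OreLocalization.OreSet (S h) := (nonempty_oreSet h).some

/-- `𝓑 = A_h[S⁻¹]`, the Ore localization of `A_h` at `S = {ψⁿ}`. -/
abbrev Loc (h : k[X]) : Type _ := OreLocalization (S h) (OreExt h)

/-- The canonical map `A_h → 𝓑`. -/
def toLoc (h : k[X]) : OreExt h →ₐ[k] Loc h :=
  { (OreLocalization.numeratorRingHom : OreExt h →+* Loc h) with commutes' := fun _ => rfl }

theorem toLoc_apply (h : k[X]) (a : OreExt h) : toLoc h a = OreLocalization.numeratorHom a := rfl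

theorem isUnit_toLoc (h : k[X]) (s : S h) : IsUnit (toLoc h s) :=
  OreLocalization.numerator_isUnit s

/-- `ψ` as an element of `S`. -/
def psiS (h : k[X]) : S h := ⟨poly h (psi h), Submonoid.mem_powers _⟩

/-- For `u ∈ A_h`, the element `ψ⁻¹ u` of `𝓑`. -/
def divPsi (h : k[X]) (u : OreExt h) : Loc h := u /ₒ psiS h

theorem toLoc_psi_mul_divPsi (h : k[X]) (u : OreExt h) :
    toLoc h (poly h (psi h)) * divPsi h u = toLoc h u := by
  exact OreLocalization.mul_cancel (s := psiS h) (t := 1)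

theorem toLoc_injective {h : k[X]} (hh : h ≠ 0) : Function.Injective (toLoc h) := by
  refine OreLocalization.numeratorHom_inj ?_
  rintro _ ⟨n, rfl⟩ a ha
  change poly h (psi h) ^ n * a = 0 at ha
  rw [← map_pow] at ha
  exact poly_mul_left_cancel (pow_ne_zero n (psi_ne_zero hh)) ha

/-- Extension to `𝓑` of an algebra endomorphism of `A_h` which maps `ψ` to a unit of `𝓑`. It is
the unique one, by `ext_unique`. -/
def ext (h : k[X]) (f : OreExt h →ₐ[k] OreExt h) (hf : IsUnit (toLoc h (f (poly h (psi h))))) :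
    Loc h →+* Loc h :=
  have hu : ∀ s : S h, IsUnit ((((toLoc h).comp f : OreExt h →* Loc h).comp (S h).subtype) s) := by
    rintro ⟨_, n, rfl⟩
    simpa using hf.pow n
  OreLocalization.universalHom ((toLoc h).comp f : OreExt h →+* Loc h)
    (IsUnit.liftRight _ hu) (fun s => (IsUnit.coe_liftRight _ hu s).symm)

theorem ext_toLoc (h : k[X]) (f : OreExt h →ₐ[k] OreExt h)
    (hf : IsUnit (toLoc h (f (poly h (psi h))))) (a : OreExt h) :
    ext h f hf (toLoc h a) = toLoc h (f a) :=
  OreLocalization.universalHom_commutes _ _ _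

theorem ext_unique (h : k[X]) (f : OreExt h →ₐ[k] OreExt h)
    (hf : IsUnit (toLoc h (f (poly h (psi h))))) (g : Loc h →+* Loc h)
    (hg : ∀ a, g (toLoc h a) = toLoc h (f a)) : g = ext h f hf :=
  OreLocalization.universalHom_unique _ _ _ g hg

/-! ### The automorphisms `σ_r` and `τ_a` -/

/-- `σ_r` as an endomorphism. -/
def sigmaHom (h r : k[X]) : OreExt h →ₐ[k] OreExt h :=
  lift h (x h) (t h + poly h r) (by
    change _ = _ + poly h h
    rw [add_mul, mul_add, t_mul_x, ← poly_X, poly_comm h r X]; abel)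

theorem sigmaHom_poly (h r p : k[X]) : sigmaHom h r (poly h p) = poly h p := by
  rw [poly, ← aeval_algHom_apply, sigmaHom, lift_x]

theorem sigmaHom_comp (h r r' : k[X]) (hr : r + r' = 0) :
    (sigmaHom h r).comp (sigmaHom h r') = AlgHom.id k _ := by
  refine algHom_ext ?_ ?_
  · simp [sigmaHom]
  · rw [AlgHom.comp_apply]
    conv_lhs => rw [sigmaHom.eq_def h r', lift_t, map_add, sigmaHom_poly, sigmaHom, lift_t]
    rw [add_assoc, ← map_add, hr]; simp

/-- The automorphism `σ_r`: `x ↦ x`, `t ↦ t + r(x)`. -/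
def sigma (h r : k[X]) : OreExt h ≃ₐ[k] OreExt h :=
  AlgEquiv.ofAlgHom (sigmaHom h r) (sigmaHom h (-r)) (sigmaHom_comp h _ _ (by simp))
    (sigmaHom_comp h _ _ (by simp))

theorem sigma_x (h r : k[X]) : sigma h r (x h) = x h := lift_x _ _ _ _

theorem sigma_t (h r : k[X]) : sigma h r (t h) = t h + poly h r := lift_t _ _ _ _

/-- The condition `h(ax) = a^N h(x)`, where `N = deg h`. -/
def Admissible (h : k[X]) (a : kˣ) : Prop :=
  h.comp (C (a : k) * X) = C ((a : k) ^ h.natDegree) * h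

theorem Admissible.inv {h : k[X]} {a : kˣ} (ha : Admissible h a) : Admissible h a⁻¹ := by
  have e := congrArg (fun p => C (((a⁻¹ : kˣ) : k) ^ h.natDegree) * p.comp (C ((a⁻¹ : kˣ) : k) * X)) ha
  simp only [comp_assoc, mul_comp, C_comp, X_comp] at e
  rw [← mul_assoc, ← mul_assoc, ← C_mul, ← C_mul, ← mul_pow, Units.mul_inv, Units.inv_mul,
    one_pow, C_1, one_mul, one_mul, comp_X] at e
  exact e.symm

theorem poly_comp (h p : k[X]) (a : k) : aeval (a • x h) p = poly h (p.comp (C a * X)) := by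
  rw [poly, aeval_comp]
  congr 1
  simp [Algebra.smul_def]

/-- `τ_a` as an endomorphism. -/
def tauHom (h : k[X]) (a : kˣ) (ha : Admissible h a) : OreExt h →ₐ[k] OreExt h :=
  lift h ((a : k) • x h) (((a ^ ((h.natDegree : ℤ) - 1) : kˣ) : k) • t h) (by
    have e : ((a ^ ((h.natDegree : ℤ) - 1) : kˣ) : k) * (a : k) = (a : k) ^ h.natDegree := by
      rw [← Units.val_mul, ← zpow_add_one, sub_add_cancel, zpow_natCast, Units.val_pow_eq_pow_val]
    rw [poly_comp, ha, smul_mul_smul_comm, smul_mul_smul_comm, mul_comm (a : k), e, t_mul_x,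
      smul_add, ← smul_eq_C_mul, map_smul])

theorem tauHom_poly (h : k[X]) (a : kˣ) (ha : Admissible h a) (p : k[X]) :
    tauHom h a ha (poly h p) = poly h (p.comp (C (a : k) * X)) := by
  rw [← poly_comp, poly, ← aeval_algHom_apply, tauHom, lift_x]

theorem tauHom_comp (h : k[X]) (a b : kˣ) (ha : Admissible h a) (hb : Admissible h b)
    (hab : a * b = 1) : (tauHom h a ha).comp (tauHom h b hb) = AlgHom.id k _ := by
  refine algHom_ext ?_ ?_
  · simp [tauHom, smul_smul, ← Units.val_mul, mul_comm b a, hab]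
  · simp only [tauHom, AlgHom.comp_apply, lift_t, map_smul, smul_smul, ← Units.val_mul,
      ← mul_zpow, mul_comm b a, hab, one_zpow, Units.val_one, one_smul, AlgHom.id_apply]

/-- The automorphism `τ_a`: `x ↦ a x`, `t ↦ a^(N-1) t`, defined when `h(ax) = a^N h(x)`. -/
def tau (h : k[X]) (a : kˣ) (ha : Admissible h a) : OreExt h ≃ₐ[k] OreExt h :=
  AlgEquiv.ofAlgHom (tauHom h a ha) (tauHom h a⁻¹ ha.inv) (tauHom_comp h _ _ _ _ (by simp))
    (tauHom_comp h _ _ _ _ (by simp))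

theorem tau_x (h : k[X]) (a : kˣ) (ha : Admissible h a) : tau h a ha (x h) = (a : k) • x h :=
  lift_x _ _ _ _

theorem tau_t (h : k[X]) (a : kˣ) (ha : Admissible h a) :
    tau h a ha (t h) = ((a ^ ((h.natDegree : ℤ) - 1) : kˣ) : k) • t h :=
  lift_t _ _ _ _

/-- The automorphism `ρ = σ_r ∘ τ_a`. -/
def rho (h r : k[X]) (a : kˣ) (ha : Admissible h a) : OreExt h ≃ₐ[k] OreExt h :=
  (tau h a ha).trans (sigma h r)

theorem rho_poly (h r : k[X]) (a : kˣ) (ha : Admissible h a) (p : k[X]) :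
    rho h r a ha (poly h p) = poly h (p.comp (C (a : k) * X)) := by
  change sigmaHom h r (tauHom h a ha (poly h p)) = _
  rw [tauHom_poly, sigmaHom_poly]

theorem psi_comp_dvd (h : k[X]) (a : kˣ) (ha : Admissible h a) :
    (psi h).comp (C (a : k) * X) ∣ psi h := by
  have hu : ∀ n : ℕ, IsUnit (C ((a : k) ^ n)) := fun n => (a.isUnit.pow n).map C
  have key : ∀ p q : k[X], p ∣ q → p.comp (C (a : k) * X) ∣ q.comp (C (a : k) * X) :=
    fun p q hpq => map_dvd (compRingHom (C (a : k) * X)) hpq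
  refine dvd_psi ?_ ?_
  · have := key _ _ (psi_dvd h)
    rw [ha] at this
    exact (hu _).dvd_mul_left.1 this
  · have := (key _ _ (psi_dvd_derivative h)).mul_left (C (a : k))
    have e := congrArg derivative ha
    rw [derivative_comp, derivative_C_mul, derivative_C_mul, derivative_X, mul_one] at e
    rw [e] at this
    exact (hu _).dvd_mul_left.1 this

theorem isUnit_rho_psi (h r : k[X]) (a : kˣ) (ha : Admissible h a) :
    IsUnit (toLoc h ((rho h r a ha : OreExt h →ₐ[k] OreExt h) (poly h (psi h)))) := by
  change IsUnit (toLoc h (rho h r a ha (poly h (psi h))))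
  rw [rho_poly]
  obtain ⟨q, hq⟩ := psi_comp_dvd h a ha
  have hs := isUnit_toLoc h (psiS h)
  change IsUnit (toLoc h (poly h (psi h))) at hs
  rw [hq, map_mul, map_mul] at hs
  have hc : Commute (toLoc h (poly h ((psi h).comp (C (a : k) * X)))) (toLoc h (poly h q)) := by
    rw [Commute, SemiconjBy, ← map_mul (toLoc h), ← map_mul (toLoc h), poly_comm]
  exact (hc.isUnit_mul_iff.1 hs).1

/-- The extension of `ρ = σ_r ∘ τ_a` to `𝓑`. -/
def rhoLoc (h r : k[X]) (a : kˣ) (ha : Admissible h a) : Loc h →+* Loc h :=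
  ext h (rho h r a ha) (isUnit_rho_psi h r a ha)

/-! ### Derivations of `A_h` -/

/-- The inner derivation `ad_w = [w, -]`. -/
def inner (h : k[X]) (w : OreExt h) : OreExt h →ₗ[k] OreExt h :=
  LinearMap.mulLeft k w - LinearMap.mulRight k w

theorem inner_apply (h : k[X]) (w f : OreExt h) : inner h w f = w * f - f * w := rfl

/-- The algebra map `f ↦ f + Δ_s(f) ε` into the dual numbers over `A_h`. -/
def deltaHom (h s : k[X]) : OreExt h →ₐ[k] TrivSqZeroExt (OreExt h) (OreExt h) :=
  lift h (TrivSqZeroExt.inl (x h)) (TrivSqZeroExt.inl (t h) + TrivSqZeroExt.inr (poly h s)) (by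
    have e : aeval (TrivSqZeroExt.inl (x h) : TrivSqZeroExt (OreExt h) (OreExt h)) h
        = TrivSqZeroExt.inl (poly h h) := by
      rw [poly]
      exact aeval_algHom_apply (TrivSqZeroExt.inlAlgHom k (OreExt h) (OreExt h)) (x h) h
    rw [e]
    refine TrivSqZeroExt.ext ?_ ?_
    · simp [t_mul_x]
    · simpa using poly_comm h s X)

/-- `Δ_s`: the derivation of `A_h` with `Δ_s(x) = 0` and `Δ_s(t) = s(x)`. -/
def delta (h s : k[X]) : OreExt h →ₗ[k] OreExt h :=
  (TrivSqZeroExt.sndHom (OreExt h) (OreExt h)).restrictScalars k ∘ₗ (deltaHom h s).toLinearMap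

theorem delta_x (h s : k[X]) : delta h s (x h) = 0 := by
  change (deltaHom h s (x h)).snd = 0
  simp [deltaHom]

theorem delta_t (h s : k[X]) : delta h s (t h) = poly h s := by
  change (deltaHom h s (t h)).snd = _
  simp [deltaHom]

theorem delta_mul (h s : k[X]) (f g : OreExt h) :
    delta h s (f * g) = f * delta h s g + delta h s f * g := by
  have e : ∀ f, (deltaHom h s f).fst = f := fun f => by
    have := algHom_ext (f := (TrivSqZeroExt.fstHom k (OreExt h) (OreExt h)).comp (deltaHom h s))
      (g := AlgHom.id k _) (by simp [deltaHom]) (by simp [deltaHom])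
    exact DFunLike.congr_fun this f
  change (deltaHom h s (f * g)).snd = f * (deltaHom h s g).snd + (deltaHom h s f).snd * g
  rw [map_mul, TrivSqZeroExt.snd_mul, e, e]
  rfl

/-- The inner derivation `[c, -]` of `𝓑`. -/
def innerLoc (h : k[X]) (c : Loc h) : Loc h →ₗ[k] Loc h :=
  LinearMap.mulLeft k c - LinearMap.mulRight k c

theorem innerLoc_apply (h : k[X]) (c f : Loc h) : innerLoc h c f = c * f - f * c := rfl

theorem mul_h (h : k[X]) (a : OreExt h) : ∃ b, a * poly h h = poly h h * b := by
  induction a using induct with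
  | hC c => exact ⟨_, Algebra.commutes _ _⟩
  | hx => exact ⟨x h, by rw [← poly_X, poly_comm]⟩
  | ht => exact ⟨t h + poly h (derivative h), by rw [t_mul_poly, map_mul, mul_add]⟩
  | hadd a b ha hb =>
    obtain ⟨a', ha⟩ := ha
    obtain ⟨b', hb⟩ := hb
    exact ⟨a' + b', by rw [add_mul, mul_add, ha, hb]⟩
  | hmul a b ha hb =>
    obtain ⟨a', ha⟩ := ha
    obtain ⟨b', hb⟩ := hb
    exact ⟨a' * b', by rw [mul_assoc, hb, ← mul_assoc, ha, mul_assoc]⟩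

theorem comm_mem (h : k[X]) (g : OreExt h) (hx : ∃ b, x h * g - g * x h = poly h h * b)
    (ht : ∃ b, t h * g - g * t h = poly h h * b) (a : OreExt h) :
    ∃ b, a * g - g * a = poly h h * b := by
  induction a using induct with
  | hC c => exact ⟨0, by rw [Algebra.commutes, sub_self, mul_zero]⟩
  | hx => exact hx
  | ht => exact ht
  | hadd a b ha hb =>
    obtain ⟨a', ha⟩ := ha
    obtain ⟨b', hb⟩ := hb
    exact ⟨a' + b', by rw [mul_add (poly h h), ← ha, ← hb]; noncomm_ring⟩
  | hmul a b ha hb =>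
    obtain ⟨a', ha⟩ := ha
    obtain ⟨b', hb⟩ := hb
    obtain ⟨c, hc⟩ := mul_h h a
    refine ⟨c * b' + a' * b, ?_⟩
    rw [mul_add (poly h h), ← mul_assoc (poly h h), ← hc, mul_assoc a (poly h h), ← hb,
      ← mul_assoc (poly h h), ← ha]
    noncomm_ring

theorem innerLoc_divPsi_mem (h : k[X]) (H f : OreExt h) :
    innerLoc h (divPsi h H) (toLoc h f) ∈ LinearMap.range (toLoc h).toLinearMap := by
  obtain ⟨q, hq⟩ := psi_dvd h
  have hu : IsUnit (toLoc h (poly h (psi h))) := isUnit_toLoc h (psiS h)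
  have hx : ∃ b, H * x h - x h * H = poly h h * b :=
    comm_mem h (x h) ⟨0, by simp⟩ ⟨1, by rw [t_mul_x]; simp⟩ H
  have ht : ∃ b, H * t h - t h * H = poly h h * b :=
    comm_mem h (t h) ⟨-1, by rw [t_mul_x]; simp⟩ ⟨0, by simp⟩ H
  have hc := toLoc_psi_mul_divPsi h H
  have hc' : ∀ a, toLoc h (poly h (psi h)) * (divPsi h H * a) = toLoc h H * a := fun a => by
    rw [← mul_assoc, hc]
  have hqh : poly h h = poly h (psi h) * poly h q := by rw [← map_mul, ← hq]
  induction f using induct with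
  | hC c =>
    refine ⟨0, ?_⟩
    simp [innerLoc_apply, Algebra.commutes]
  | hx =>
    obtain ⟨v, hv⟩ := hx
    refine ⟨poly h q * v, hu.mul_left_cancel ?_⟩
    change _ * toLoc h _ = _
    rw [innerLoc_apply, mul_sub, hc', ← mul_assoc, ← map_mul, ← map_mul, ← map_mul, ← poly_X,
      poly_comm h (psi h) X, map_mul _ (poly h X), mul_assoc, hc, ← map_mul, ← map_sub, poly_X, hv,
      hqh, mul_assoc]
  | ht =>
    obtain ⟨v, hv⟩ := ht
    have hd : psi h ∣ q * derivative (psi h) := by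
      have e := psi_dvd_derivative h
      have e' : derivative h = derivative (psi h) * q + psi h * derivative q := by
        conv_lhs => rw [hq]
        exact derivative_mul
      rw [e'] at e
      rw [mul_comm]
      exact (dvd_add_left (dvd_mul_right _ _)).1 e
    obtain ⟨p, hp⟩ := hd
    have e2 : h * derivative (psi h) = psi h * p * psi h := by
      have e3 : h * derivative (psi h) = psi h * (q * derivative (psi h)) := by
        rw [← mul_assoc, ← hq]
      rw [e3, hp]; ring
    have e3 : poly h (psi h) * t h = t h * poly h (psi h) - poly h (psi h * p) * poly h (psi h) := by
      rw [t_mul_poly, ← map_mul, ← e2]; abel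
    refine ⟨poly h q * v + poly h p * H, hu.mul_left_cancel ?_⟩
    change _ * toLoc h _ = _
    rw [innerLoc_apply, mul_sub, hc', ← mul_assoc, ← map_mul (toLoc h) _ (t h),
      ← map_mul (toLoc h) _ (t h), ← map_mul (toLoc h) _ (poly h q * v + _), e3, map_sub, sub_mul,
      map_mul _ (t h), map_mul _ (poly h (psi h * p)), mul_assoc, hc, mul_assoc, hc, ← map_mul,
      ← map_mul, ← map_sub, ← map_sub, mul_add, ← mul_assoc, ← hqh, ← hv, ← mul_assoc,
      map_mul (poly h)]
    congr 1
    abel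
  | hadd a b ha hb =>
    rw [map_add, map_add]
    exact add_mem ha hb
  | hmul a b ha hb =>
    obtain ⟨a', ha⟩ := ha
    obtain ⟨b', hb⟩ := hb
    refine ⟨a * b' + a' * b, ?_⟩
    change toLoc h _ = _ at ha hb ⊢
    rw [map_add, map_mul, map_mul, ha, hb, innerLoc_apply, innerLoc_apply, innerLoc_apply, map_mul]
    noncomm_ring

/-- `E_H`: the derivation `f ↦ [ψ⁻¹ H, f]` of `A_h`; the bracket is taken in `𝓑` and its value lies
in the subalgebra `A_h` of `𝓑`. -/
def E {h : k[X]} (hh : h ≠ 0) (H : OreExt h) : OreExt h →ₗ[k] OreExt h :=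
  (LinearEquiv.ofInjective (toLoc h).toLinearMap (toLoc_injective hh)).symm.toLinearMap ∘ₗ
    LinearMap.codRestrict (LinearMap.range (toLoc h).toLinearMap)
      (innerLoc h (divPsi h H) ∘ₗ (toLoc h).toLinearMap) (innerLoc_divPsi_mem h H)

theorem toLoc_E {h : k[X]} (hh : h ≠ 0) (H f : OreExt h) :
    toLoc h (E hh H f) = divPsi h H * toLoc h f - toLoc h f * divPsi h H := by
  have := LinearEquiv.apply_symm_apply
    (LinearEquiv.ofInjective (toLoc h).toLinearMap (toLoc_injective hh))
    (LinearMap.codRestrict (LinearMap.range (toLoc h).toLinearMap)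
      (innerLoc h (divPsi h H) ∘ₗ (toLoc h).toLinearMap) (innerLoc_divPsi_mem h H) f)
  exact congrArg Subtype.val this

/-- `H = h₁ t + ⋯ + hₙ tⁿ` with `hᵢ ∈ k[x]` and `deg hᵢ < deg ψ`; the case `n = 0` is `H = 0`. -/
def IsSpecial (h : k[X]) (H : OreExt h) : Prop :=
  ∃ (n : ℕ) (c : ℕ → k[X]), (∀ i ∈ Finset.Icc 1 n, (c i).degree < (psi h).degree) ∧
    H = ∑ i ∈ Finset.Icc 1 n, poly h (c i) * t h ^ i

/-- The derivation `D = ad_w + E_H + Δ_s`. -/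
def der {h : k[X]} (hh : h ≠ 0) (w H : OreExt h) (s : k[X]) : OreExt h →ₗ[k] OreExt h :=
  inner h w + E hh H + delta h s

theorem der_mul {h : k[X]} (hh : h ≠ 0) (w H : OreExt h) (s : k[X]) (f g : OreExt h) :
    der hh w H s (f * g) = f * der hh w H s g + der hh w H s f * g := by
  have hE : E hh H (f * g) = f * E hh H g + E hh H f * g := by
    apply toLoc_injective hh
    rw [map_add, map_mul (toLoc h), map_mul (toLoc h), toLoc_E, toLoc_E, toLoc_E, map_mul (toLoc h)]
    noncomm_ring
  simp only [der, LinearMap.add_apply, hE, delta_mul, inner_apply]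
  noncomm_ring

/-- The element `w* = w + ψ⁻¹ H` of `𝓑`. -/
def wStar (h : k[X]) (w H : OreExt h) : Loc h := toLoc h w + divPsi h H

/-- `Aut_D(A_h)`: the automorphisms `ρ` of `A_h` with `ρ D = D ρ`. -/
def isotropy (h : k[X]) (D : OreExt h →ₗ[k] OreExt h) : Subgroup (OreExt h ≃ₐ[k] OreExt h) where
  carrier := {ρ | ∀ f, ρ (D f) = D (ρ f)}
  one_mem' _ := rfl
  mul_mem' {a b} ha hb f := by
    rw [AlgEquiv.mul_apply, AlgEquiv.mul_apply, hb, ha]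
  inv_mem' {a} ha f := by
    apply a.injective
    rw [ha]
    change a (a.symm _) = D (a (a.symm f))
    rw [a.apply_symm_apply, a.apply_symm_apply]

/-! ### The ring `R_S = k[x][ψ⁻¹]` and its derivation `d_S` -/

/-- `R_S = k[x][S⁻¹]`, the localization of `k[x]` at the powers of `ψ`. -/
abbrev RS (h : k[X]) : Type _ := Localization.Away (psi h)

/-- The canonical map `R_S → 𝓑`. -/
def RSToLoc (h : k[X]) : RS h →+* Loc h :=
  have hu : ∀ s : Submonoid.powers (psi h),
      IsUnit ((((toLoc h).comp (poly h) : k[X] →* Loc h).comp (Submonoid.powers (psi h)).subtype) s) := by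
    rintro ⟨_, n, rfl⟩
    simpa [psiS] using (isUnit_toLoc h (psiS h)).pow n
  OreLocalization.universalHom ((toLoc h).comp (poly h) : k[X] →+* Loc h)
    (IsUnit.liftRight _ hu) (fun s => (IsUnit.coe_liftRight _ hu s).symm)

theorem RSToLoc_algebraMap (h p : k[X]) :
    RSToLoc h (algebraMap k[X] (RS h) p) = toLoc h (poly h p) :=
  OreLocalization.universalHom_commutes _ _ _

theorem RSToLoc_injective {h : k[X]} (hh : h ≠ 0) : Function.Injective (RSToLoc h) := by
  rw [injective_iff_map_eq_zero]
  intro u hu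
  obtain ⟨⟨p, s⟩, hp⟩ := IsLocalization.surj (Submonoid.powers (psi h)) u
  have e := congrArg (RSToLoc h) hp
  rw [map_mul, hu, zero_mul, RSToLoc_algebraMap, eq_comm, map_eq_zero_iff _ (toLoc_injective hh),
    map_eq_zero_iff _ (poly_injective h)] at e
  change p = 0 at e
  rw [e] at hp
  simp only [map_zero] at hp
  exact ((IsLocalization.map_units (RS h) s).mul_left_eq_zero).1 hp

/-- The ring map `f ↦ f + d(f) ε`, `d = h ∂_x`, from `k[x]` to the dual numbers over `R_S`. -/
def dHom (h : k[X]) : k[X] →+* TrivSqZeroExt (RS h) (RS h) where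
  toFun f := TrivSqZeroExt.inl (algebraMap _ _ f) +
    TrivSqZeroExt.inr (algebraMap _ _ (h * derivative f))
  map_one' := by simp
  map_zero' := by simp
  map_add' f g := by
    refine TrivSqZeroExt.ext ?_ ?_ <;> simp [mul_add]
  map_mul' f g := by
    refine TrivSqZeroExt.ext ?_ ?_
    · simp
    · simp; ring

/-- The ring map `u ↦ u + d_S(u) ε` on `R_S`. -/
def dSHom (h : k[X]) : RS h →+* TrivSqZeroExt (RS h) (RS h) :=
  IsLocalization.lift (M := Submonoid.powers (psi h)) (g := dHom h) (by
    intro s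
    rw [TrivSqZeroExt.isUnit_iff_isUnit_fst]
    simpa [dHom] using IsLocalization.map_units (RS h) s)

theorem fst_dSHom (h : k[X]) (u : RS h) : (dSHom h u).fst = u := by
  have := IsLocalization.ringHom_ext (Submonoid.powers (psi h))
    (j := (TrivSqZeroExt.fstHom k (RS h) (RS h) : _ →+* RS h).comp (dSHom h))
    (k := RingHom.id (RS h)) (by ext <;> simp [dSHom, dHom])
  exact DFunLike.congr_fun this u

/-- `d_S`: the extension of the derivation `d = h ∂_x` of `k[x]` to `R_S`. -/
def dS (h : k[X]) : Derivation k (RS h) (RS h) :=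
  Derivation.mk'
    { toFun := fun u => (dSHom h u).snd
      map_add' := fun u v => by simp
      map_smul' := fun c u => by
        have e : dSHom h (algebraMap k (RS h) c) = TrivSqZeroExt.inl (algebraMap k (RS h) c) := by
          rw [IsScalarTower.algebraMap_apply k k[X] (RS h), dSHom, IsLocalization.lift_eq]
          simp [dHom]
        rw [Algebra.smul_def, map_mul, e]
        simp [Algebra.smul_def] }
    (fun u v => by
      change (dSHom h (u * v)).snd = u • (dSHom h v).snd + v • (dSHom h u).snd
      rw [map_mul, TrivSqZeroExt.snd_mul, fst_dSHom, fst_dSHom, op_smul_eq_smul])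

theorem dS_algebraMap (h f : k[X]) :
    dS h (algebraMap k[X] (RS h) f) = algebraMap k[X] (RS h) (h * derivative f) := by
  change (dSHom h _).snd = _
  rw [dSHom, IsLocalization.lift_eq]
  simp [dHom]

end DiffOre

end

/-!
Both `ρ D` and `D ρ` are derivations of `A_h` along `ρ`, so `ρ` commutes with `D` as soon as it does
so on the generators `x` and `t`. Write `v = ρ(w*) - w*`. In `𝓑` the derivation `D` is
`[w*, -] + Δ_s`, and `ρ(x) = a x`, `ρ(t) = a^(N-1) (t + r)`. Hence

* `ρ D x = D ρ x` says that `v` commutes with `x`;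
* `ρ D t = D ρ t` says that `a^(N-1) [v, t + r] + s(ax) - a^(N-1) s = 0`.

The first condition means `v ∈ R_S`, because `R_S` is the centralizer of `x` in `𝓑`
(`exists_RSToLoc_eq_of_commute`). After clearing denominators this is the statement that `k[x]` is
the centralizer of `x` in `A_h` (`exists_poly_eq_of_commute`): in the commutator with `x` of an
element `p₀ + ⋯ + pₙ tⁿ` the coefficient of `t^(n-1)` is `n h pₙ`, which is nonzero in
characteristic zero when `n ≥ 1` and `pₙ ≠ 0`. For `v ∈ R_S` we have `[v, r] = 0` and
`[t, v] = d_S(v)` (`toLoc_t_mul_RSToLoc`), so the second condition is the stated equation.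
-/

open Polynomial

noncomputable section

namespace DiffOre

variable {k : Type*} [Field k]

/-! ### The centralizer of `x` in `A_h` -/

theorem coeff_coeffD (h : k[X]) (p : k[X][X]) (i : ℕ) :
    (coeffD h p).coeff i = h * derivative (p.coeff i) := by
  induction p using Polynomial.induction_on' with
  | add a b ha hb => simp only [map_add, coeff_add, ha, hb, mul_add]
  | monomial n c =>
    rw [coeffD_monomial, coeff_monomial, coeff_monomial]
    split_ifs <;> simp

/-- The normal form of `tⁿ p` is `∑ (n choose i) dⁿ⁻ⁱ(p) tⁱ`, where `d = h ∂_x`. -/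
theorem coeff_opT_pow (h p : k[X]) (n i : ℕ) :
    ((opT h ^ n) (C p)).coeff i
      = (n.choose i : k[X]) * (fun q => h * derivative q)^[n - i] p := by
  induction n generalizing i with
  | zero =>
    rcases i with _ | i
    · simp
    · simp [coeff_C_succ]
  | succ n ih =>
    rw [pow_succ', Module.End.mul_apply]
    generalize hq : (opT h ^ n) (C p) = q at ih ⊢
    simp only [opT, LinearMap.add_apply, LinearMap.mulLeft_apply, coeff_add, coeff_coeffD]
    rcases i with _ | i
    · rw [ih, coeff_X_mul_zero, Nat.sub_zero, Nat.sub_zero, Function.iterate_succ_apply']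
      simp
    · rw [coeff_X_mul, ih, ih, Nat.choose_succ_succ, Nat.add_sub_add_right]
      rcases Nat.lt_or_ge i n with hi | hi
      · obtain ⟨m, rfl⟩ := Nat.exists_eq_add_of_lt hi
        rw [show i + m + 1 - i = m + 1 by omega, show i + m + 1 - (i + 1) = m by omega,
          Function.iterate_succ_apply', derivative_mul, derivative_natCast]
        push_cast
        ring
      · rw [Nat.choose_eq_zero_of_lt (show n < i + 1 by omega)]
        simp

theorem rep_nf (h : k[X]) (p q : k[X][X]) :
    rep h (nf h p) q = p.sum fun j c => C c * (opT h ^ j) q := by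
  rw [nf, eval₂_eq_sum, sum_def, sum_def, map_sum, LinearMap.sum_apply]
  refine Finset.sum_congr rfl fun j _ => ?_
  rw [map_mul, map_pow, Module.End.mul_apply]
  change rep h (poly h _) _ = _
  rw [rep_poly, rep, lift_t]

/-- The centralizer of `x` in `A_h` is `k[x]`. -/
theorem exists_poly_eq_of_commute [CharZero k] {h : k[X]} (hh : h ≠ 0) {f : OreExt h}
    (hf : f * x h = x h * f) : ∃ p, poly h p = f := by
  set p := rep h f 1 with hp
  have hnf : nf h p = f := nf_rep_one h f
  have hcomm : rep h (nf h p) (C X) = C X * p := by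
    have e := congrArg (fun g => rep h g 1) hf
    rw [← poly_X] at e
    simpa only [map_mul, Module.End.mul_apply, rep_poly, mul_one, hnf] using e
  obtain hn | ⟨n, hn⟩ : p.natDegree = 0 ∨ ∃ n, p.natDegree = n + 1 := by
    cases p.natDegree <;> simp
  · refine ⟨p.coeff 0, ?_⟩
    rw [← hnf]
    conv_rhs => rw [eq_C_of_natDegree_eq_zero hn, ← monomial_zero_left, nf_monomial]
    simp
  · exfalso
    have e := congrArg (fun q => q.coeff n) hcomm
    -- Only the terms `n` and `n + 1` contribute to the coefficient of `tⁿ`.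
    simp only [rep_nf, sum_over_range' p (f := fun j c => C c * (opT h ^ j) (C X)) (by simp)
      (n + 2) (by omega), finsetSum_coeff, coeff_C_mul, coeff_opT_pow] at e
    rw [Finset.sum_range_succ, Finset.sum_range_succ, Finset.sum_eq_zero] at e
    · simp only [Nat.choose_self, Nat.cast_one, Nat.sub_self, Function.iterate_zero, id_eq,
        zero_add, one_mul, Nat.choose_succ_self_right, Nat.add_sub_cancel_left,
        Function.iterate_one, derivative_X, mul_one] at e
      rw [mul_comm X, add_eq_left] at e
      have hlead : p.coeff (n + 1) ≠ 0 := by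
        rw [← hn, coeff_natDegree, Ne, leadingCoeff_eq_zero]
        rintro h0
        rw [h0] at hn
        simp at hn
      exact mul_ne_zero hlead (mul_ne_zero (Nat.cast_ne_zero.2 (Nat.succ_ne_zero n)) hh) e
    · intro j hj
      rw [Nat.choose_eq_zero_of_lt (Finset.mem_range.1 hj)]
      simp

/-! ### The ring `R_S` inside `𝓑` -/

theorem isUnit_toLoc_poly_of_mem_powers (h : k[X]) (q : Submonoid.powers (psi h)) :
    IsUnit (toLoc h (poly h q)) := by
  obtain ⟨_, n, rfl⟩ := q
  simpa [psiS] using (isUnit_toLoc h (psiS h)).pow n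

/-- The centralizer of `x` in `𝓑` is `R_S`. -/
theorem exists_RSToLoc_eq_of_commute [CharZero k] {h : k[X]} (hh : h ≠ 0) {v : Loc h}
    (hv : v * toLoc h (x h) = toLoc h (x h) * v) : ∃ u, RSToLoc h u = v := by
  obtain ⟨n, f, hf⟩ : ∃ (n : ℕ) (f : OreExt h), toLoc h (poly h (psi h ^ n)) * v = toLoc h f := by
    induction v using OreLocalization.ind with
    | _ f q =>
      obtain ⟨_, n, rfl⟩ := q
      refine ⟨n, f, ?_⟩
      rw [map_pow]
      exact OreLocalization.mul_cancel (s := (⟨_, n, rfl⟩ : S h)) (t := 1)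
  have hfx : f * x h = x h * f := by
    apply toLoc_injective hh
    rw [map_mul, map_mul, ← hf, mul_assoc, hv, ← mul_assoc, ← mul_assoc, ← map_mul, ← map_mul,
      ← poly_X, poly_comm]
  obtain ⟨p, rfl⟩ := exists_poly_eq_of_commute hh hfx
  let q : Submonoid.powers (psi h) := ⟨psi h ^ n, n, rfl⟩
  refine ⟨IsLocalization.mk' (RS h) p q, (isUnit_toLoc_poly_of_mem_powers h q).mul_left_cancel ?_⟩
  rw [hf, ← RSToLoc_algebraMap, ← map_mul, IsLocalization.mk'_spec', RSToLoc_algebraMap]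

theorem toLoc_poly_mul_RSToLoc (h p : k[X]) (u : RS h) :
    toLoc h (poly h p) * RSToLoc h u = RSToLoc h u * toLoc h (poly h p) := by
  rw [← RSToLoc_algebraMap, ← map_mul, ← map_mul, mul_comm]

/-- On `R_S`, the inner derivation `[t, -]` of `𝓑` is `d_S`. -/
theorem toLoc_t_mul_RSToLoc (h : k[X]) (u : RS h) :
    toLoc h (t h) * RSToLoc h u = RSToLoc h u * toLoc h (t h) + RSToLoc h (dS h u) := by
  have ht : ∀ p, toLoc h (t h) * RSToLoc h (algebraMap k[X] (RS h) p)
      = RSToLoc h (algebraMap k[X] (RS h) p) * toLoc h (t h) + RSToLoc h (dS h (algebraMap k[X] (RS h) p)) := by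
    intro p
    rw [dS_algebraMap, RSToLoc_algebraMap, RSToLoc_algebraMap, ← map_mul, ← map_mul, ← map_add,
      t_mul_poly]
  obtain ⟨⟨p, q⟩, hp⟩ := IsLocalization.surj (Submonoid.powers (psi h)) u
  refine (isUnit_toLoc_poly_of_mem_powers h q).mul_right_cancel ?_
  have hd : RSToLoc h (dS h (algebraMap k[X] (RS h) p))
      = RSToLoc h u * RSToLoc h (dS h (algebraMap k[X] (RS h) q))
        + RSToLoc h (dS h u) * toLoc h (poly h q) := by
    rw [← hp, Derivation.leibniz, map_add, smul_eq_mul, smul_eq_mul, map_mul, map_mul,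
      RSToLoc_algebraMap, toLoc_poly_mul_RSToLoc]
  have e := ht p
  rw [hd, ← hp, map_mul] at e
  simp only [← RSToLoc_algebraMap] at e ⊢
  rw [mul_assoc, e, mul_assoc, add_mul, mul_assoc, ht, mul_add]
  abel

/-! ### Commutation of `ρ` and `D` -/

theorem rho_x (h r : k[X]) (a : kˣ) (ha : Admissible h a) :
    rho h r a ha (x h) = (a : k) • x h := by
  change sigma h r (tau h a ha (x h)) = _
  rw [tau_x, map_smul, sigma_x]

theorem rho_t (h r : k[X]) (a : kˣ) (ha : Admissible h a) :
    rho h r a ha (t h) = ((a ^ ((h.natDegree : ℤ) - 1) : kˣ) : k) • (t h + poly h r) := by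
  change sigma h r (tau h a ha (t h)) = _
  rw [tau_t, map_smul, sigma_t]

theorem rhoLoc_toLoc (h r : k[X]) (a : kˣ) (ha : Admissible h a) (f : OreExt h) :
    rhoLoc h r a ha (toLoc h f) = toLoc h (rho h r a ha f) :=
  ext_toLoc _ _ _ _

/-- In `𝓑` the derivation `D` is `[w*, -] + Δ_s`. -/
theorem toLoc_der {h : k[X]} (hh : h ≠ 0) (w H : OreExt h) (s : k[X]) (f : OreExt h) :
    toLoc h (der hh w H s f)
      = wStar h w H * toLoc h f - toLoc h f * wStar h w H + toLoc h (delta h s f) := by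
  simp only [der, LinearMap.add_apply, map_add, toLoc_E, inner_apply, map_sub, map_mul, wStar]
  noncomm_ring

theorem delta_poly (h s p : k[X]) : delta h s (poly h p) = 0 := by
  induction p using Polynomial.induction_on with
  | C c =>
    have h1 : delta h s 1 = 0 := by simpa using delta_mul h s 1 1
    rw [← algebraMap_eq, AlgHom.commutes, Algebra.algebraMap_eq_smul_one, map_smul, h1, smul_zero]
  | add p q hp hq => rw [map_add, map_add, hp, hq, add_zero]
  | monomial n c ih =>
    rw [pow_succ, ← mul_assoc, map_mul, delta_mul, ih, poly_X, delta_x, mul_zero, zero_mul,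
      add_zero]

theorem rho_mem_isotropy_iff {h : k[X]} (hh : h ≠ 0) (w H : OreExt h) (s r : k[X]) (a : kˣ)
    (ha : Admissible h a) :
    rho h r a ha ∈ isotropy h (der hh w H s) ↔
      rho h r a ha (der hh w H s (x h)) = der hh w H s (rho h r a ha (x h)) ∧
      rho h r a ha (der hh w H s (t h)) = der hh w H s (rho h r a ha (t h)) := by
  refine ⟨fun hρ => ⟨hρ _, hρ _⟩, fun ⟨hx, ht⟩ f => ?_⟩
  induction f using induct with
  | hC c =>
    have h1 : der hh w H s 1 = 0 := by simpa using der_mul hh w H s 1 1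
    rw [AlgEquiv.commutes, Algebra.algebraMap_eq_smul_one, map_smul, h1, smul_zero, map_zero]
  | hx => exact hx
  | ht => exact ht
  | hadd f g hf hg => simp only [map_add, hf, hg]
  | hmul f g hf hg => simp only [map_mul, der_mul, map_add, hf, hg]

/-- Commutation of `ρ` and `D` on `x` means that `ρ(w*) - w*` commutes with `x`. -/
theorem rho_der_x_iff {h : k[X]} (hh : h ≠ 0) (w H : OreExt h) (s r : k[X]) (a : kˣ)
    (ha : Admissible h a) (v : Loc h) (hv : v = rhoLoc h r a ha (wStar h w H) - wStar h w H) :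
    rho h r a ha (der hh w H s (x h)) = der hh w H s (rho h r a ha (x h)) ↔
      v * toLoc h (x h) = toLoc h (x h) * v := by
  rw [← (toLoc_injective hh).eq_iff, ← rhoLoc_toLoc, toLoc_der, toLoc_der, map_add, map_sub,
    map_mul, map_mul, rhoLoc_toLoc, rhoLoc_toLoc, rho_x, delta_x, map_zero, map_smul, map_smul,
    delta_x, smul_zero, map_zero, ← sub_eq_zero, ← sub_eq_zero (a := v * _),
    ← smul_eq_zero_iff_right (a.ne_zero : (a : k) ≠ 0) (m := v * _ - _), hv]
  refine Eq.congr ?_ rfl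
  simp only [mul_smul_comm, smul_mul_assoc, smul_sub, sub_mul, mul_sub]
  abel

/-- Commutation of `ρ` and `D` on `t`, when `u = ρ(w*) - w*` lies in `R_S`, is the equation for
`d_S(u)`. -/
theorem rho_der_t_iff {h : k[X]} (hh : h ≠ 0) (w H : OreExt h) (s r : k[X]) (a : kˣ)
    (ha : Admissible h a) (u : RS h)
    (hu : RSToLoc h u = rhoLoc h r a ha (wStar h w H) - wStar h w H) :
    rho h r a ha (der hh w H s (t h)) = der hh w H s (rho h r a ha (t h)) ↔
      dS h u = algebraMap k[X] (RS h)
        (C ((a ^ (1 - (h.natDegree : ℤ)) : kˣ) : k) * s.comp (C (a : k) * X) - s) := by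
  set b : k := ((a ^ ((h.natDegree : ℤ) - 1) : kˣ) : k) with hb
  have hb0 : b ≠ 0 := Units.ne_zero _
  have hbinv : b * ((a ^ (1 - (h.natDegree : ℤ)) : kˣ) : k) = 1 := by
    rw [hb, ← Units.val_mul, ← zpow_add, show (h.natDegree : ℤ) - 1 + (1 - h.natDegree) = 0 by ring,
      zpow_zero, Units.val_one]
  have hs : poly h (s.comp (C (a : k) * X))
      = b • poly h (C ((a ^ (1 - (h.natDegree : ℤ)) : kˣ) : k) * s.comp (C (a : k) * X)) := by
    rw [← smul_eq_C_mul (p := s.comp _), map_smul, smul_smul, hbinv, one_smul]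
  have hρ : rhoLoc h r a ha (wStar h w H) = RSToLoc h u + wStar h w H := by
    rw [hu, sub_add_cancel]
  rw [← (RSToLoc_injective hh).eq_iff, RSToLoc_algebraMap, map_sub (poly h), map_sub (toLoc h),
    ← (toLoc_injective hh).eq_iff, ← rhoLoc_toLoc, toLoc_der, toLoc_der, map_add, map_sub,
    map_mul, map_mul, rhoLoc_toLoc, rhoLoc_toLoc, rho_t, delta_t, rho_poly, hs, hρ, ← hb]
  simp only [map_smul, map_add, delta_t, delta_poly, add_zero]
  have hr := toLoc_poly_mul_RSToLoc h r u
  have ht := toLoc_t_mul_RSToLoc h u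
  rw [← sub_eq_zero, ← sub_eq_zero (a := RSToLoc h (dS h u)), ← neg_eq_zero,
    ← smul_eq_zero_iff_right hb0 (m := RSToLoc h (dS h u) - _)]
  refine Eq.congr ?_ rfl
  simp only [mul_smul_comm, smul_mul_assoc, ← smul_add, ← smul_sub, ← smul_neg]
  congr 1
  simp only [add_mul, mul_add, hr, ht]
  abel

end DiffOre

end

theorem mainTheorem1 {k : Type*} [Field k] [CharZero k] (h : k[X]) (hh : h ≠ 0)
    (w H : DiffOre.OreExt h) (hH : DiffOre.IsSpecial h H)
    (s : k[X]) (hs : s.degree < h.degree)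
    (r : k[X]) (a : kˣ) (ha : DiffOre.Admissible h a) :
    DiffOre.rho h r a ha ∈ DiffOre.isotropy h (DiffOre.der hh w H s) ↔
      ∃ u : DiffOre.RS h,
        DiffOre.RSToLoc h u =
          DiffOre.rhoLoc h r a ha (DiffOre.wStar h w H) - DiffOre.wStar h w H ∧
        DiffOre.dS h u = algebraMap k[X] (DiffOre.RS h)
          (C ((a ^ (1 - (h.natDegree : ℤ)) : kˣ) : k) * s.comp (C (a : k) * X) - s) := by
  rw [DiffOre.rho_mem_isotropy_iff]
  constructor
  · rintro ⟨hx, ht⟩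
    obtain ⟨u, hu⟩ :=
      DiffOre.exists_RSToLoc_eq_of_commute hh ((DiffOre.rho_der_x_iff hh w H s r a ha _ rfl).1 hx)
    exact ⟨u, hu, (DiffOre.rho_der_t_iff hh w H s r a ha u hu).1 ht⟩
  · rintro ⟨u, hu, hd⟩
    refine ⟨(DiffOre.rho_der_x_iff hh w H s r a ha _ hu).2 ?_,
      (DiffOre.rho_der_t_iff hh w H s r a ha u hu).2 hd⟩
    rw [← DiffOre.poly_X, DiffOre.toLoc_poly_mul_RSToLoc]
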